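/- Let $K,A,B$ be finite sets ($A,B$ nonempty), $n\ge 1$, $p\in\Delta(K)$, $M_k\in\mathbb R^{A\times B}$ for $k\in K$, and let $Q_a$ ($a\in A$) be row-stochastic $K\times K$ matrices. In the $n$-stage zero-sum game $\Gamma_n(p)$ the initial state $k_1$ has law $p$, and $k_{t+1}$ has law $Q_{a_t}(k_t,\cdot)$; at each stage the players simultaneously choose $a_t\in A$ and $b_t\in B$, which are observed by both, while only player 1 (the maximizer) observes the states. Behavior strategies are $\sigma=(\sigma_t)_{t\le n}$ with $\sigma_t:K^t\times A^{t-1}\times B^{t-1}\to\Delta(A)$ and $\tau=(\tau_t)_{t\le n}$ with $\tau_t:A^{t-1}\times B^{t-1}\to\Delta(B)$, and the payoff is $\gamma_n(p,\sigma,\tau)=\mathbf E_{p,\sigma,\tau}\big[\sum_{t=1}^n M_{k_t}(a_t,b_t)\big]$. A security strategy of player 2 is a $\tau$ attaining $\min_\tau\max_\sigma\gamma_n(p,\sigma,\tau)$. For $\alpha\in\mathbb R^K$, in the dual game $G_n(\alpha)$ player 1 chooses $q\in\Delta(K)$ and $\sigma$, player 2 chooses $\tau$, and the payoff is $\mathbf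 E_{q,\sigma,\tau}\big[\alpha(k_1)+\sum_{t=1}^n M_{k_t}(a_t,b_t)\big]$; its value (the common value of maxmin and minmax) is $w_n(\alpha)$. The history-based linear program of the uninformed player (player 2) has as variables $y_{I}\in\Delta(B)$ for $I\in A^{t-1}$, $1\le t\le n$, and $\ell_{S,I}\in\mathbb R$ for $(S,I)\in K^t\times A^{t-1}$, $1\le t\le n$. It is to minimize $\sum_{k\in K}p(k)\,\ell_{(k),\emptyset}$ subject to $$\sum_{k'\in K}\ell_{(S,k'),(I,a)}\le \ell_{S,I}\qquad (S\in K^{t},\ I\in A^{t-1},\ a\in A,\ 1\le t<n),$$ $$\prod_{t=1}^{n-1}Q_{a_t}(k_t,k_{t+1})\sum_{t=1}^n\sum_{b\in B}M_{k_t}(a_t,b)\,y_{(a_1,\dots,a_{t-1})}(b)\le \ell_{(k_1,\dots,k_n),(a_1,\dots,a_{n-1})}\qquad\big((k_t)\in K^n,\ (a_t)\in A^n\big).$$ Proposition. Let $(y^*,\ell^*)$ be an optimal solution of this linear program, and let $\ell^*_1=(\ell^*_{(k),\emptyset})_{k\in K}\in\mathbb R^K$. Then the dual game $G_n(\alpha)$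 has a value $w_n(\alpha)$ for every $\alpha\in\mathbb R^K$, and $-\ell^*_1$ is an optimal solution of $$\min_{\alpha\in\mathbb R^K}\{w_n(\alpha)-p^T\alpha\}.$$ Moreover, the strategy $\tau^*_t(a_1,\dots,a_{t-1},b_1,\dots,b_{t-1})=y^*_{(a_1,\dots,a_{t-1})}$ is a security strategy of player 2 in $\Gamma_n(p)$, and $-\ell^*_1$ is the initial regret of $\Gamma_n(p)$ with respect to $\tau^*$ on the support of $p$: for every $k\in K$ with $p(k)>0$, $$-\ell^*_{(k),\emptyset}=-\max_{\sigma}\mathbf E_{\sigma,\tau^*}\Big[\sum_{t=1}^n M_{k_t}(a_t,b_t)\,\Big|\,k_1=k\Big].$$ -/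

import Mathlib

namespace AsymGame

/-- The value of a two-player zero-sum game with payoff `u x y`, where the player choosing `x`
maximizes and the player choosing `y` minimizes: `v` is at the same time
`max_x min_y u x y` and `min_y max_x u x y`, all these extrema being attained. -/
structure IsValue {X Y : Type*} (u : X → Y → ℝ) (v : ℝ) : Prop where
  maxmin : IsGreatest {c : ℝ | ∃ x, IsLeast (Set.range fun y => u x y) c} v
  minmax : IsLeast {c : ℝ | ∃ y, IsGreatest (Set.range fun x => u x y) c} v

/-- `y` is a security strategy of the minimizing player: `max_x u x y` is the minmax value. -/
def IsMinSecurity {X Y : Type*} (u : X → Y → ℝ) (y : Y) : Prop :=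
  ∃ v : ℝ, IsLeast {c : ℝ | ∃ y', IsGreatest (Set.range fun x => u x y') c} v ∧
    IsGreatest (Set.range fun x => u x y) v

/-- The first `t` entries of a finite sequence. -/
def pre {X : Type*} {n : ℕ} (x : Fin n → X) (t : ℕ) (h : t ≤ n) : Fin t → X :=
  fun i => x (Fin.castLE h i)

/-- The finite sequence `x` extended by one entry `a` at its end. -/
def ext {X : Type*} {t : ℕ} (x : Fin t → X) (a : X) : Fin (t + 1) → X :=
  Fin.snoc (α := fun _ => X) x a

/-- The data `(K, A, B, M, Q)` of a zero-sum stochastic game whose state is controlled by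
player 1: `payoff k a b` is `M_k(a, b)`, and `trans a k` is the law `Q_a(k, ·)` of the next state. -/
structure StochasticGame (K A B : Type*) [Fintype K] where
  payoff : K → A → B → ℝ
  trans : A → K → stdSimplex ℝ K

section Strategies

variable (K A B : Type*) [Fintype A] [Fintype B]

/-- Behavior strategies of the informed player in the game with `m + 1` stages. Stages are numbered
`0, …, m`; at stage `t` the player knows the states `0, …, t` and all actions before stage `t`. -/
def InformedStrategy (m : ℕ) : Type _ :=
  (t : Fin (m + 1)) → (Fin (t + 1) → K) → (Fin t → A) → (Fin t → B) → stdSimplex ℝ A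

/-- Behavior strategies of the uninformed player in the game with `m + 1` stages. At stage `t` the
player knows all actions played before stage `t`, and no state. -/
def UninformedStrategy (m : ℕ) : Type _ :=
  (t : Fin (m + 1)) → (Fin t → A) → (Fin t → B) → stdSimplex ℝ B

/-- The variables `y = (y_{I_t})` of the linear program: one mixed action of the uninformed player
for every stage and every action history of the informed player. -/
def PlanY (m : ℕ) : Type _ :=
  (t : Fin (m + 1)) → (Fin t → A) → stdSimplex ℝ B

/-- The variables `ℓ = (ℓ_{F_t})` of the linear program: one real number for every stage, every
state history (including the current state) and every action history of the informed player. -/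
def PlanL (K A : Type*) (m : ℕ) : Type _ :=
  (t : Fin (m + 1)) → (Fin (t + 1) → K) → (Fin t → A) → ℝ

variable {K A B}

/-- The strategy of the uninformed player that plays `y_{I_t}` at stage `t`. -/
def PlanY.toStrategy {m : ℕ} (y : PlanY A B m) : UninformedStrategy A B m :=
  fun t I _ => y t I

/-- The vector `ℓ_1 = (ℓ_{F_1})`, where `F_1 = (k, ∅)` for `k` in `K`. -/
def PlanL.first {m : ℕ} (l : PlanL K A m) : K → ℝ :=
  fun k => l ⟨0, Nat.succ_pos m⟩ (fun _ => k) (fun i => i.elim0)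

end Strategies

namespace StochasticGame

variable {K A B : Type*} [Fintype K] [Fintype A] [Fintype B] (G : StochasticGame K A B) {m : ℕ}

/-- The product of the transition probabilities `Q_{a_t}(k_t, k_{t+1})` along a path. -/
noncomputable def transProd (k : Fin (m + 1) → K) (a : Fin (m + 1) → A) : ℝ :=
  ∏ t : Fin m, (G.trans (a t.castSucc) (k t.castSucc) : K → ℝ) (k t.succ)

/-- The probability of the play `(k, a, b)` under the initial law `p` and the strategies `σ, τ`. -/
noncomputable def playProb (p : stdSimplex ℝ K) (σ : InformedStrategy K A B m)
    (τ : UninformedStrategy A B m) (k : Fin (m + 1) → K) (a : Fin (m + 1) → A)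
    (b : Fin (m + 1) → B) : ℝ :=
  (p : K → ℝ) (k 0) * G.transProd k a *
    ∏ t : Fin (m + 1),
      (σ t (pre k (t + 1) t.isLt) (pre a t t.isLt.le) (pre b t t.isLt.le) : A → ℝ) (a t) *
      (τ t (pre a t t.isLt.le) (pre b t t.isLt.le) : B → ℝ) (b t)

/-- The expectation of a function `f` of the play. -/
noncomputable def expect (p : stdSimplex ℝ K) (σ : InformedStrategy K A B m)
    (τ : UninformedStrategy A B m)
    (f : (Fin (m + 1) → K) → (Fin (m + 1) → A) → (Fin (m + 1) → B) → ℝ) : ℝ :=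
  ∑ k : Fin (m + 1) → K, ∑ a : Fin (m + 1) → A, ∑ b : Fin (m + 1) → B,
    G.playProb p σ τ k a b * f k a b

/-- The total payoff of the primal game `Γ_{m+1}(p)`. -/
noncomputable def primalPayoff (p : stdSimplex ℝ K) (σ : InformedStrategy K A B m)
    (τ : UninformedStrategy A B m) : ℝ :=
  G.expect p σ τ fun k a b => ∑ t, G.payoff (k t) (a t) (b t)

/-- The total payoff of the dual game `G_{m+1}(α)`, in which player 1 also chooses the law of the
initial state. -/
noncomputable def dualPayoff (α : K → ℝ) (x : stdSimplex ℝ K × InformedStrategy K A B m)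
    (τ : UninformedStrategy A B m) : ℝ :=
  G.expect x.1 x.2 τ fun k a b => α (k 0) + ∑ t, G.payoff (k t) (a t) (b t)

open Classical in
/-- The expected total payoff given that the initial state is `k`. -/
noncomputable def payoffFrom (k : K) (σ : InformedStrategy K A B m)
    (τ : UninformedStrategy A B m) : ℝ :=
  G.primalPayoff ⟨Pi.single k 1, single_mem_stdSimplex ℝ k⟩ σ τ

/-- `r` is the coordinate at `k` of the initial regret determined by the strategy `τ` of the
uninformed player: minus the maximal expected total payoff against `τ` when the initial state
is `k`. -/
def IsInitialRegretAt (τ : UninformedStrategy A B m) (k : K) (r : ℝ) : Prop :=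
  IsGreatest (Set.range fun σ : InformedStrategy K A B m => G.payoffFrom k σ τ) (-r)

/-- The constraints of the history based linear program of the uninformed player. -/
structure LPFeasible (y : PlanY A B m) (l : PlanL K A m) : Prop where
  step : ∀ (t : ℕ) (ht : t + 1 < m + 1) (S : Fin (t + 1) → K) (I : Fin t → A) (a : A),
    ∑ k : K, l ⟨t + 1, ht⟩ (ext S k) (ext I a) ≤ l ⟨t, Nat.lt_of_succ_lt ht⟩ S I
  final : ∀ (k : Fin (m + 1) → K) (a : Fin (m + 1) → A),
    G.transProd k a *
        ∑ t : Fin (m + 1), ∑ b : B,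
          G.payoff (k t) (a t) b * (y t (pre a t t.isLt.le) : B → ℝ) b ≤
      l ⟨m, Nat.lt_succ_self m⟩ k (pre a m (Nat.le_succ m))

/-- `(y, ℓ)` is an optimal solution of the history based linear program of the uninformed player:
minimize `∑ k, p(k) ℓ_{(k, ∅)}` subject to the constraints. -/
structure LPOptimal (p : stdSimplex ℝ K) (y : PlanY A B m) (l : PlanL K A m) : Prop where
  feasible : G.LPFeasible y l
  le_of_feasible : ∀ (y' : PlanY A B m) (l' : PlanL K A m), G.LPFeasible y' l' →
    ∑ k, (p : K → ℝ) k * l.first k ≤ ∑ k, (p : K → ℝ) k * l'.first k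

end StochasticGame

end AsymGame

set_option linter.unusedSectionVars false

/-! The bounds of the program are dynamic-programming bounds scaled by transition probabilities. If
`(y, l)` is feasible, then against the plan `y` no strategy with initial law `q` gets more than `∑
q(k) (α(k) + l_k)` in the dual game (`FullFeasible.dualPayoff_le`). Conversely, backward induction
gives for each plan bounds attained by a pure strategy that is blind to the opponent's actions
(`exists_tight_pureBlind`). Against a blind strategy, any `τ` yields the same payoff as its average
over player 2's past actions, which is a plan (`dualPayoff_average`). Hence every `τ` concedes at
least the value of the program, and the optimal plan concedes no more: it is a security strategy.

The same two reductions leave only blind strategies and plans to consider in the dual game. There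
the payoff is affine in the plan and linear in the realization weights, so Sion's theorem gives a
saddle point (`exists_saddlePoint`).

With `L = ℓ*_1`, the upper bound gives `w(-L) ≤ 0` and the lower bound gives `w(α) ≥ p·(α + L)`, so
`w(α) - p·α ≥ p·L ≥ w(-L) + p·L`. For the regret, the attained bounds of `y*` lie below `L`, and
optimality of `p·L` forces equality where `p > 0`. -/

namespace AsymGame

/-! ### Finite sequences and their last entry -/

section Sequences

variable {X : Type*} {t : ℕ}

theorem pre_ext (x : Fin t → X) (a : X) (s : ℕ) (h : s ≤ t) (h' : s ≤ t + 1) :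
    pre (ext x a) s h' = pre x s h := by
  funext i
  exact Fin.snoc_castSucc (α := fun _ => X) a x (Fin.castLE h i)

theorem pre_self (x : Fin t → X) (h : t ≤ t) : pre x t h = x := rfl

@[simp] theorem ext_castSucc (x : Fin t → X) (a : X) (s : Fin t) : ext x a s.castSucc = x s :=
  Fin.snoc_castSucc (α := fun _ => X) a x s

@[simp] theorem ext_last (x : Fin t → X) (a : X) : ext x a (Fin.last t) = a :=
  Fin.snoc_last (α := fun _ => X) a x

theorem ext_zero (x : Fin (t + 1) → X) (a : X) : ext x a 0 = x 0 :=
  ext_castSucc x a 0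

theorem ext_pre_last (x : Fin (t + 1) → X) : ext (pre x t t.le_succ) (x (Fin.last t)) = x :=
  Fin.snoc_init_self (α := fun _ => X) x

theorem sum_ext [Fintype X] (F : (Fin (t + 1) → X) → ℝ) :
    ∑ x, F x = ∑ x : Fin t → X, ∑ a, F (ext x a) := by
  rw [← Equiv.sum_comp (Fin.snocEquiv fun _ : Fin (t + 1) => X), Fintype.sum_prod_type_right]
  rfl

end Sequences

/-! ### Strategies indexed by all stages -/

section FullStrategies

variable (K A B : Type*) [Fintype A] [Fintype B]

/-- Behavior strategies of the informed player without a bound on the number of stages. -/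
abbrev FullInformed : Type _ :=
  (t : ℕ) → (Fin (t + 1) → K) → (Fin t → A) → (Fin t → B) → stdSimplex ℝ A

/-- Behavior strategies of the uninformed player without a bound on the number of stages. -/
abbrev FullUninformed : Type _ :=
  (t : ℕ) → (Fin t → A) → (Fin t → B) → stdSimplex ℝ B

/-- Behavior strategies of the informed player that disregard the actions of the opponent. -/
abbrev FullBlind : Type _ :=
  (t : ℕ) → (Fin (t + 1) → K) → (Fin t → A) → stdSimplex ℝ A

/-- Plans of the uninformed player without a bound on the number of stages. -/
abbrev FullPlan : Type _ :=
  (t : ℕ) → (Fin t → A) → stdSimplex ℝ B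

variable {K A B}

/-- The restriction of a strategy of the informed player to the first `m + 1` stages. -/
def FullInformed.restrict (σ : FullInformed K A B) (m : ℕ) : InformedStrategy K A B m :=
  fun t => σ t

/-- The restriction of a strategy of the uninformed player to the first `m + 1` stages. -/
def FullUninformed.restrict (τ : FullUninformed A B) (m : ℕ) : UninformedStrategy A B m :=
  fun t => τ t

/-- The restriction of a plan to the first `m + 1` stages. -/
def FullPlan.restrict (y : FullPlan A B) (m : ℕ) : PlanY A B m :=
  fun t => y t

/-- The strategy of the uninformed player that follows a plan. -/
def FullPlan.toFull (y : FullPlan A B) : FullUninformed A B :=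
  fun t I _ => y t I

/-- A strategy that disregards the actions of the opponent, as a strategy. -/
def FullBlind.toFull (β : FullBlind K A) : FullInformed K A B :=
  fun t S I _ => β t S I

/-- The values after the horizon are arbitrary, since no payoff reads them. Indexing stages by `ℕ`
permits induction on the stage. -/
theorem exists_restrict_informed [Nonempty A] {m : ℕ} (σ : InformedStrategy K A B m) :
    ∃ σ' : FullInformed K A B, σ'.restrict m = σ :=
  ⟨fun t => if h : t < m + 1 then σ ⟨t, h⟩ else fun _ _ _ => Classical.arbitrary _,
    funext fun t => dif_pos t.isLt⟩

theorem exists_restrict_uninformed [Nonempty B] {m : ℕ} (τ : UninformedStrategy A B m) :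
    ∃ τ' : FullUninformed A B, τ'.restrict m = τ :=
  ⟨fun t => if h : t < m + 1 then τ ⟨t, h⟩ else fun _ _ => Classical.arbitrary _,
    funext fun t => dif_pos t.isLt⟩

theorem exists_restrict_plan [Nonempty B] {m : ℕ} (y : PlanY A B m) :
    ∃ y' : FullPlan A B, y'.restrict m = y :=
  ⟨fun t => if h : t < m + 1 then y ⟨t, h⟩ else fun _ => Classical.arbitrary _,
    funext fun t => dif_pos t.isLt⟩

theorem exists_restrict_bound {m : ℕ} (l : PlanL K A m) :
    ∃ l' : (t : ℕ) → (Fin (t + 1) → K) → (Fin t → A) → ℝ, (fun t : Fin (m + 1) => l' t) = l :=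
  ⟨fun t => if h : t < m + 1 then l ⟨t, h⟩ else fun _ _ => 0,
    funext fun t => dif_pos t.isLt⟩

end FullStrategies

/-! ### Weighted sums over histories -/

namespace StochasticGame

variable {K A B : Type*} [Fintype K] [Fintype A] [Fintype B] (G : StochasticGame K A B)

/-- The product of the transition probabilities along the first `T` stages. -/
noncomputable def transWeight (T : ℕ) (k : Fin (T + 1) → K) (a : Fin T → A) : ℝ :=
  ∏ s : Fin T, G.trans (a s) (k s.castSucc) (k s.succ)

theorem transWeight_ext (T : ℕ) (k : Fin (T + 1) → K) (a : Fin T → A) (k' : K) (a' : A) :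
    G.transWeight (T + 1) (ext k k') (ext a a') =
      G.transWeight T k a * G.trans a' (k (Fin.last T)) k' := by
  unfold transWeight
  rw [Fin.prod_univ_castSucc]
  congr 1
  · refine Finset.prod_congr rfl fun s _ => ?_
    rw [ext_castSucc, ext_castSucc, ← Fin.castSucc_succ, ext_castSucc]
  · rw [ext_last, ext_castSucc, Fin.succ_last, ext_last]

theorem transProd_ext {m : ℕ} (k : Fin (m + 1) → K) (a : Fin m → A) (a' : A) :
    G.transProd k (ext a a') = G.transWeight m k a :=
  Finset.prod_congr rfl fun s _ => by rw [ext_castSucc]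

/-- The probability of the actions of the first `T` stages and of the first state, given the states
that are visited. -/
noncomputable def choiceWeight (q : stdSimplex ℝ K) (σ : FullInformed K A B)
    (τ : FullUninformed A B) (T : ℕ) (k : Fin (T + 1) → K) (a : Fin T → A) (b : Fin T → B) : ℝ :=
  q (k 0) * ∏ s : Fin T,
    (σ s (pre k (s + 1) (by omega)) (pre a s s.isLt.le) (pre b s s.isLt.le) (a s) *
      τ s (pre a s s.isLt.le) (pre b s s.isLt.le) (b s))

theorem choiceWeight_ext (q : stdSimplex ℝ K) (σ : FullInformed K A B)
    (τ : FullUninformed A B) (T : ℕ) (k : Fin (T + 1) → K) (a : Fin T → A) (b : Fin T → B)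
    (k' : K) (a' : A) (b' : B) :
    choiceWeight q σ τ (T + 1) (ext k k') (ext a a') (ext b b') =
      choiceWeight q σ τ T k a b * (σ T k a b a' * τ T a b b') := by
  unfold choiceWeight
  rw [Fin.prod_univ_castSucc, ext_zero, mul_assoc]
  congr 2
  · refine Finset.prod_congr rfl fun s _ => ?_
    simp only [Fin.val_castSucc, ext_castSucc]
    rw [pre_ext a a' s s.isLt.le, pre_ext b b' s s.isLt.le, pre_ext k k' (s + 1) (by omega)]
  · simp only [Fin.val_last, ext_last]
    rw [pre_ext a a' T le_rfl, pre_ext b b' T le_rfl, pre_ext k k' (T + 1) le_rfl]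
    rfl

theorem choiceWeight_nonneg (q : stdSimplex ℝ K) (σ : FullInformed K A B)
    (τ : FullUninformed A B) (T : ℕ) (k : Fin (T + 1) → K) (a : Fin T → A) (b : Fin T → B) :
    0 ≤ choiceWeight q σ τ T k a b :=
  mul_nonneg (q.2.1 _) (Finset.prod_nonneg fun _ _ =>
    mul_nonneg ((σ _ _ _ _).2.1 _) ((τ _ _ _).2.1 _))

/-- The sum of `f` over the histories of length `T`, weighted by `choiceWeight`. -/
noncomputable def choiceSum (q : stdSimplex ℝ K) (σ : FullInformed K A B)
    (τ : FullUninformed A B) (T : ℕ)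
    (f : (Fin (T + 1) → K) → (Fin T → A) → (Fin T → B) → ℝ) : ℝ :=
  ∑ k, ∑ a, ∑ b, choiceWeight q σ τ T k a b * f k a b

/-- The mean of a function of the actions at stage `T`, given the history before stage `T`. -/
noncomputable def stageMean (σ : FullInformed K A B) (τ : FullUninformed A B) (T : ℕ)
    (k : Fin (T + 1) → K) (a : Fin T → A) (b : Fin T → B) (g : A → B → ℝ) : ℝ :=
  ∑ a', σ T k a b a' * ∑ b', τ T a b b' * g a' b'

/-- Conditioning on the history before the last stage. The new state is summed without weight
because transition probabilities are kept in the summand, just as they are absorbed in the variables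
`l` of the program. -/
theorem choiceSum_succ (q : stdSimplex ℝ K) (σ : FullInformed K A B)
    (τ : FullUninformed A B) (T : ℕ)
    (f : (Fin (T + 2) → K) → (Fin (T + 1) → A) → (Fin (T + 1) → B) → ℝ) :
    choiceSum q σ τ (T + 1) f = choiceSum q σ τ T fun k a b =>
      stageMean σ τ T k a b fun a' b' => ∑ k', f (ext k k') (ext a a') (ext b b') := by
  unfold choiceSum stageMean
  rw [sum_ext]
  refine Finset.sum_congr rfl fun k _ => ?_
  simp_rw [sum_ext, choiceWeight_ext, Finset.mul_sum]
  rw [Finset.sum_comm]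
  refine Finset.sum_congr rfl fun a _ => ?_
  rw [Finset.sum_congr rfl fun k' _ => Finset.sum_comm, Finset.sum_comm]
  refine Finset.sum_congr rfl fun b _ => ?_
  rw [Finset.sum_comm]
  refine Finset.sum_congr rfl fun a' _ => ?_
  rw [Finset.sum_comm]
  refine Finset.sum_congr rfl fun b' _ => Finset.sum_congr rfl fun k' _ => ?_
  ring

theorem expect_restrict (q : stdSimplex ℝ K) (σ : FullInformed K A B) (τ : FullUninformed A B)
    (m : ℕ) (f : (Fin (m + 1) → K) → (Fin (m + 1) → A) → (Fin (m + 1) → B) → ℝ) :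
    G.expect q (σ.restrict m) (τ.restrict m) f = choiceSum q σ τ m fun k a b =>
      stageMean σ τ m k a b fun a' b' => G.transWeight m k a * f k (ext a a') (ext b b') := by
  have hp : ∀ k a b a' b', G.playProb q (σ.restrict m) (τ.restrict m) k (ext a a') (ext b b') =
      choiceWeight q σ τ m k a b * (σ m k a b a' * τ m a b b') * G.transWeight m k a := by
    intro k a b a' b'
    unfold playProb choiceWeight
    rw [transProd_ext, Fin.prod_univ_castSucc]
    have h1 : ∀ s : Fin m, ((σ.restrict m) s.castSucc (pre k (s + 1) (by omega))
          (pre (ext a a') s (by omega)) (pre (ext b b') s (by omega)) (ext a a' s.castSucc) *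
        (τ.restrict m) s.castSucc (pre (ext a a') s (by omega)) (pre (ext b b') s (by omega))
          (ext b b' s.castSucc)) =
        σ s (pre k (s + 1) (by omega)) (pre a s s.isLt.le) (pre b s s.isLt.le) (a s) *
          τ s (pre a s s.isLt.le) (pre b s s.isLt.le) (b s) := by
      intro s
      rw [ext_castSucc, ext_castSucc, pre_ext a a' s s.isLt.le, pre_ext b b' s s.isLt.le]
      rfl
    have h2 : ((σ.restrict m) (Fin.last m) (pre k (m + 1) le_rfl)
          (pre (ext a a') m (by omega)) (pre (ext b b') m (by omega)) (ext a a' (Fin.last m)) *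
        (τ.restrict m) (Fin.last m) (pre (ext a a') m (by omega)) (pre (ext b b') m (by omega))
          (ext b b' (Fin.last m))) = σ m k a b a' * τ m a b b' := by
      rw [ext_last, ext_last, pre_ext a a' m le_rfl, pre_ext b b' m le_rfl]
      rfl
    rw [← Finset.prod_congr rfl fun s _ => h1 s, ← h2]
    simp only [Fin.val_castSucc, Fin.val_last]
    ring
  unfold expect choiceSum stageMean
  refine Finset.sum_congr rfl fun k _ => ?_
  simp_rw [sum_ext, hp, Finset.mul_sum]
  refine Finset.sum_congr rfl fun a _ => ?_
  rw [Finset.sum_comm]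
  refine Finset.sum_congr rfl fun b _ => Finset.sum_congr rfl fun a' _ =>
    Finset.sum_congr rfl fun b' _ => ?_
  ring

theorem choiceSum_mono (q : stdSimplex ℝ K) (σ : FullInformed K A B)
    (τ : FullUninformed A B) (T : ℕ)
    {f g : (Fin (T + 1) → K) → (Fin T → A) → (Fin T → B) → ℝ} (h : ∀ k a b, f k a b ≤ g k a b) :
    choiceSum q σ τ T f ≤ choiceSum q σ τ T g :=
  Finset.sum_le_sum fun k _ => Finset.sum_le_sum fun a _ => Finset.sum_le_sum fun b _ =>
    mul_le_mul_of_nonneg_left (h k a b) (choiceWeight_nonneg q σ τ T k a b)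

theorem choiceSum_zero (q : stdSimplex ℝ K) (σ : FullInformed K A B) (τ : FullUninformed A B)
    (f : (Fin 1 → K) → (Fin 0 → A) → (Fin 0 → B) → ℝ) :
    choiceSum q σ τ 0 f = ∑ k, q k * f (fun _ => k) (fun i => i.elim0) (fun i => i.elim0) := by
  unfold choiceSum
  rw [← Equiv.sum_comp (Equiv.funUnique (Fin 1) K).symm]
  refine Finset.sum_congr rfl fun k _ => ?_
  have hk : (Equiv.funUnique (Fin 1) K).symm k = fun _ => k := by
    funext i
    rw [Subsingleton.elim i default]
    rfl
  rw [Fintype.sum_subsingleton _ fun i => i.elim0, Fintype.sum_subsingleton _ fun i => i.elim0, hk]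
  simp [choiceWeight]

/-- The supermartingale inequality: peeling off stages one at a time brings the terminal sum down to
the initial one. -/
theorem choiceSum_le_of_step (q : stdSimplex ℝ K) (σ : FullInformed K A B)
    (τ : FullUninformed A B) (m : ℕ)
    (f : (T : ℕ) → (Fin (T + 1) → K) → (Fin T → A) → (Fin T → B) → ℝ)
    (h : ∀ T < m, ∀ k a b, stageMean σ τ T k a b
      (fun a' b' => ∑ k', f (T + 1) (ext k k') (ext a a') (ext b b')) ≤ f T k a b) :
    choiceSum q σ τ m (f m) ≤
      ∑ k, q k * f 0 (fun _ => k) (fun i => i.elim0) (fun i => i.elim0) := by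
  induction m with
  | zero => exact (choiceSum_zero q σ τ _).le
  | succ m ih =>
    rw [choiceSum_succ]
    exact (choiceSum_mono q σ τ m (h m m.lt_succ_self)).trans
      (ih fun T hT => h T (hT.trans m.lt_succ_self))

theorem choiceSum_eq_of_step (q : stdSimplex ℝ K) (σ : FullInformed K A B)
    (τ : FullUninformed A B) (m : ℕ)
    (f : (T : ℕ) → (Fin (T + 1) → K) → (Fin T → A) → (Fin T → B) → ℝ)
    (h : ∀ T < m, ∀ k a b, stageMean σ τ T k a b
      (fun a' b' => ∑ k', f (T + 1) (ext k k') (ext a a') (ext b b')) = f T k a b) :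
    choiceSum q σ τ m (f m) =
      ∑ k, q k * f 0 (fun _ => k) (fun i => i.elim0) (fun i => i.elim0) := by
  induction m with
  | zero => exact choiceSum_zero q σ τ _
  | succ m ih =>
    rw [choiceSum_succ, ← ih fun T hT => h T (hT.trans m.lt_succ_self)]
    simp_rw [h m m.lt_succ_self]

end StochasticGame

/-! ### Feasible bounds and the potential -/

namespace StochasticGame

variable {K A B : Type*} [Fintype K] [Fintype A] [Fintype B] (G : StochasticGame K A B)

section StageMean

variable {G} (σ : FullInformed K A B) (τ : FullUninformed A B) (T : ℕ)
  (k : Fin (T + 1) → K) (a : Fin T → A) (b : Fin T → B)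

theorem stageMean_le_of_forall {g : A → B → ℝ} {c : ℝ}
    (h : ∀ a', ∑ b', τ T a b b' * g a' b' ≤ c) : stageMean σ τ T k a b g ≤ c := by
  calc stageMean σ τ T k a b g ≤ ∑ a', σ T k a b a' * c :=
        Finset.sum_le_sum fun a' _ => mul_le_mul_of_nonneg_left (h a') ((σ T k a b).2.1 a')
    _ = c := by rw [← Finset.sum_mul, stdSimplex.sum_eq_one, one_mul]

end StageMean

/-- The expected payoff of the first `T` stages against the plan `y`, given the states and the
actions of the informed player. -/
noncomputable def planPayoff (y : FullPlan A B) (T : ℕ) (k : Fin T → K) (a : Fin T → A) : ℝ :=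
  ∑ s : Fin T, ∑ b, G.payoff (k s) (a s) b * y s (pre a s s.isLt.le) b

theorem planPayoff_ext (y : FullPlan A B) (T : ℕ) (k : Fin (T + 1) → K) (a : Fin T → A) (a' : A) :
    G.planPayoff y (T + 1) k (ext a a') = G.planPayoff y T (pre k T T.le_succ) a +
      ∑ b, G.payoff (k (Fin.last T)) a' b * y T a b := by
  unfold planPayoff
  rw [Fin.sum_univ_castSucc]
  congr 1
  · refine Finset.sum_congr rfl fun s _ => ?_
    simp only [Fin.val_castSucc, ext_castSucc]
    rw [pre_ext a a' s s.isLt.le]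
    rfl
  · simp only [Fin.val_last, ext_last]
    rw [pre_ext a a' T le_rfl]
    rfl

/-- The constraints of the linear program for data without a bound on the number of stages. -/
structure FullFeasible (m : ℕ) (y : FullPlan A B)
    (l : (t : ℕ) → (Fin (t + 1) → K) → (Fin t → A) → ℝ) : Prop where
  step : ∀ t < m, ∀ (S : Fin (t + 1) → K) (I : Fin t → A) (a : A),
    ∑ k : K, l (t + 1) (ext S k) (ext I a) ≤ l t S I
  final : ∀ (k : Fin (m + 1) → K) (I : Fin m → A) (a : A),
    G.transWeight m k I * G.planPayoff y (m + 1) k (ext I a) ≤ l m k I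

theorem lpFeasible_restrict_iff {m : ℕ} (y : FullPlan A B)
    (l : (t : ℕ) → (Fin (t + 1) → K) → (Fin t → A) → ℝ) :
    G.LPFeasible (y.restrict m) (fun t => l t) ↔ G.FullFeasible m y l := by
  constructor
  · intro h
    refine ⟨fun t ht => h.step t (Nat.succ_lt_succ ht), fun k I a => ?_⟩
    have := h.final k (ext I a)
    rw [transProd_ext, pre_ext I a m le_rfl] at this
    exact this
  · intro h
    refine ⟨fun t ht => h.step t (Nat.lt_of_succ_lt_succ ht), fun k a => ?_⟩
    have := h.final k (pre a m m.le_succ) (a (Fin.last m))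
    rw [← transProd_ext _ _ _ (a (Fin.last m)), ext_pre_last] at this
    exact this

/-- The excess of the realized payoff of the first `T` stages over its expectation against `y`. -/
noncomputable def planExcess (y : FullPlan A B) (T : ℕ) (k : Fin T → K) (a : Fin T → A)
    (b : Fin T → B) : ℝ :=
  ∑ s : Fin T, G.payoff (k s) (a s) (b s) - G.planPayoff y T k a

theorem planExcess_ext (y : FullPlan A B) (T : ℕ) (k : Fin (T + 1) → K) (a : Fin T → A) (a' : A)
    (b : Fin T → B) (b' : B) :
    G.planExcess y (T + 1) k (ext a a') (ext b b') = G.planExcess y T (pre k T T.le_succ) a b +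
      (G.payoff (k (Fin.last T)) a' b' - ∑ b', G.payoff (k (Fin.last T)) a' b' * y T a b') := by
  unfold planExcess
  rw [planPayoff_ext, Fin.sum_univ_castSucc]
  simp only [ext_castSucc, ext_last]
  have : ∀ s : Fin T, pre k T T.le_succ s = k s.castSucc := fun _ => rfl
  simp only [this]
  ring

/-- The excess is a martingale: the increment of each stage has mean zero when player 2 draws from
`y`. -/
theorem sum_planExcess_ext (y : FullPlan A B) (T : ℕ) (k : Fin (T + 1) → K) (a : Fin T → A)
    (a' : A) (b : Fin T → B) :
    ∑ b', y T a b' * G.planExcess y (T + 1) k (ext a a') (ext b b') =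
      G.planExcess y T (pre k T T.le_succ) a b := by
  simp_rw [planExcess_ext, mul_add, mul_sub, Finset.sum_add_distrib, Finset.sum_sub_distrib,
    ← Finset.sum_mul, stdSimplex.sum_eq_one, one_mul]
  simp [mul_comm]

/-- A bound of the linear program, corrected by the realized payoffs and by the payoff that the
initial state yields in the dual game. -/
noncomputable def potential (α : K → ℝ) (y : FullPlan A B)
    (l : (t : ℕ) → (Fin (t + 1) → K) → (Fin t → A) → ℝ) (T : ℕ)
    (k : Fin (T + 1) → K) (a : Fin T → A) (b : Fin T → B) : ℝ :=
  l T k a + G.transWeight T k a * (α (k 0) + G.planExcess y T (pre k T T.le_succ) a b)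

/-- The next state sums out of the transition weight and the excess is a martingale, so one stage
changes only the `l` part. The constraints of the program control exactly that change. -/
theorem sum_potential_ext (α : K → ℝ) (y : FullPlan A B)
    (l : (t : ℕ) → (Fin (t + 1) → K) → (Fin t → A) → ℝ) (T : ℕ)
    (k : Fin (T + 1) → K) (a : Fin T → A) (a' : A) (b : Fin T → B) :
    ∑ b', y T a b' * ∑ k', G.potential α y l (T + 1) (ext k k') (ext a a') (ext b b') =
      ∑ k', l (T + 1) (ext k k') (ext a a') +
        G.transWeight T k a * (α (k 0) + G.planExcess y T (pre k T T.le_succ) a b) := by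
  have h : ∀ b', ∑ k', G.potential α y l (T + 1) (ext k k') (ext a a') (ext b b') =
      ∑ k', l (T + 1) (ext k k') (ext a a') + G.transWeight T k a *
        (α (k 0) + G.planExcess y (T + 1) k (ext a a') (ext b b')) := by
    intro b'
    unfold potential
    rw [Finset.sum_add_distrib]
    congr 1
    simp_rw [transWeight_ext, ext_zero, pre_ext k _ (T + 1) le_rfl, pre_self]
    rw [← Finset.sum_mul, ← Finset.mul_sum, stdSimplex.sum_eq_one, mul_one]
  simp_rw [h]
  rw [← sum_planExcess_ext]
  simp_rw [mul_add, Finset.sum_add_distrib, ← Finset.sum_mul, stdSimplex.sum_eq_one, one_mul,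
    Finset.mul_sum]
  congr 2
  exact Finset.sum_congr rfl fun b' _ => by ring

theorem sum_final_ext (α : K → ℝ) (y : FullPlan A B) (m : ℕ)
    (k : Fin (m + 1) → K) (a : Fin m → A) (a' : A) (b : Fin m → B) :
    ∑ b', y m a b' * (G.transWeight m k a *
        (α (k 0) + ∑ t, G.payoff (k t) (ext a a' t) (ext b b' t))) =
      G.transWeight m k a * G.planPayoff y (m + 1) k (ext a a') +
        G.transWeight m k a * (α (k 0) + G.planExcess y m (pre k m m.le_succ) a b) := by
  have h : ∀ b', ∑ t, G.payoff (k t) (ext a a' t) (ext b b' t) =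
      G.planPayoff y (m + 1) k (ext a a') + G.planExcess y (m + 1) k (ext a a') (ext b b') :=
    fun b' => by unfold planExcess; ring
  simp_rw [h]
  rw [← sum_planExcess_ext _ _ _ _ _ a']
  simp_rw [mul_add, Finset.sum_add_distrib, ← Finset.sum_mul, stdSimplex.sum_eq_one, one_mul,
    Finset.mul_sum]
  rw [add_left_comm]
  congr 2
  exact Finset.sum_congr rfl fun b' _ => by ring

variable {G}

theorem sum_potential_zero (q : stdSimplex ℝ K) (α : K → ℝ) (y : FullPlan A B)
    (l : (t : ℕ) → (Fin (t + 1) → K) → (Fin t → A) → ℝ) :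
    ∑ k, q k * G.potential α y l 0 (fun _ => k) (fun i => i.elim0) (fun i => i.elim0) =
      ∑ k, q k * (α k + l 0 (fun _ => k) (fun i => i.elim0)) := by
  refine Finset.sum_congr rfl fun k _ => ?_
  simp [potential, transWeight, planExcess, planPayoff, add_comm]

/-- Against a feasible plan the informed player gets at most the bound of the linear program. -/
theorem FullFeasible.dualPayoff_le {m : ℕ} {y : FullPlan A B}
    {l : (t : ℕ) → (Fin (t + 1) → K) → (Fin t → A) → ℝ} (h : G.FullFeasible m y l)
    (α : K → ℝ) (q : stdSimplex ℝ K) (σ : FullInformed K A B) :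
    G.dualPayoff α (q, σ.restrict m) (y.toFull.restrict m) ≤
      ∑ k, q k * (α k + l 0 (fun _ => k) (fun i => i.elim0)) := by
  rw [← sum_potential_zero (G := G) q α y l, dualPayoff, expect_restrict]
  -- The `final` constraint bounds the last stage by the potential at `m`; the `step` constraints
  -- make the potential a supermartingale down to stage `0`.
  refine le_trans (choiceSum_mono q σ _ m fun k a b => ?_)
    (choiceSum_le_of_step q σ y.toFull m (G.potential α y l) fun T hT k a b => ?_)
  · refine stageMean_le_of_forall σ _ m k a b fun a' => ?_
    exact (G.sum_final_ext α y m k a a' b).trans_le (add_le_add_left (h.final k a a') _)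
  · refine stageMean_le_of_forall σ _ T k a b fun a' => ?_
    exact (G.sum_potential_ext α y l T k a a' b).trans_le (add_le_add_left (h.step T hT k a a') _)

open Classical in
/-- The strategy that plays `g t S I` with certainty at stage `t`. -/
noncomputable def pureBlind (g : (t : ℕ) → (Fin (t + 1) → K) → (Fin t → A) → A) : FullBlind K A :=
  fun t S I => ⟨Pi.single (g t S I) 1, single_mem_stdSimplex ℝ _⟩

theorem stageMean_pureBlind (g : (t : ℕ) → (Fin (t + 1) → K) → (Fin t → A) → A)
    (τ : FullUninformed A B) (T : ℕ) (k : Fin (T + 1) → K) (a : Fin T → A) (b : Fin T → B)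
    (f : A → B → ℝ) :
    stageMean (pureBlind g).toFull τ T k a b f = ∑ b', τ T a b b' * f (g T k a) b' := by
  classical
  unfold stageMean
  rw [Finset.sum_eq_single (g T k a)]
  · have : (pureBlind g).toFull T k a b (g T k a) = 1 :=
      Pi.single_eq_same (M := fun _ : A => ℝ) (g T k a) 1
    rw [this, one_mul]
  · intro a' _ ha'
    have : (pureBlind g).toFull T k a b a' = 0 :=
      Pi.single_eq_of_ne (M := fun _ : A => ℝ) ha' 1
    rw [this, zero_mul]
  · exact fun h => (h (Finset.mem_univ _)).elim

/-- A pure strategy for which all constraints that it meets are tight gets the bound. -/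
theorem dualPayoff_pureBlind {m : ℕ} {y : FullPlan A B}
    {l : (t : ℕ) → (Fin (t + 1) → K) → (Fin t → A) → ℝ}
    {g : (t : ℕ) → (Fin (t + 1) → K) → (Fin t → A) → A}
    (hstep : ∀ t < m, ∀ S I, ∑ k : K, l (t + 1) (ext S k) (ext I (g t S I)) = l t S I)
    (hfinal : ∀ S I,
      G.transWeight m S I * G.planPayoff y (m + 1) S (ext I (g m S I)) = l m S I)
    (α : K → ℝ) (q : stdSimplex ℝ K) :
    G.dualPayoff α (q, (pureBlind g).toFull.restrict m) (y.toFull.restrict m) =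
      ∑ k, q k * (α k + l 0 (fun _ => k) (fun i => i.elim0)) := by
  rw [← sum_potential_zero (G := G) q α y l, dualPayoff, expect_restrict,
    ← choiceSum_eq_of_step q (pureBlind g).toFull y.toFull m (G.potential α y l)]
  · congr 1
    funext k a b
    rw [stageMean_pureBlind]
    refine (G.sum_final_ext α y m k a _ b).trans ?_
    rw [hfinal]
    rfl
  · intro T hT k a b
    rw [stageMean_pureBlind]
    refine (G.sum_potential_ext α y l T k a _ b).trans ?_
    rw [hstep T hT]
    rfl

/-! ### Backward induction against a plan -/

variable (G)

/-- The least bounds that satisfy the constraints for the plan `y`; here `r` is the number of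
stages that remain after stage `t`. -/
noncomputable def leastBound (y : FullPlan A B) :
    (r t : ℕ) → (Fin (t + 1) → K) → (Fin t → A) → ℝ
  | 0, t, S, I => ⨆ a, G.transWeight t S I * G.planPayoff y (t + 1) S (ext I a)
  | r + 1, t, S, I => ⨆ a, ∑ k, leastBound y r (t + 1) (ext S k) (ext I a)

/-- A plan ignores player 2's past actions, so the least bounds and their maximizing actions depend
only on states and player 1's actions. Playing a maximizer everywhere is therefore blind and makes
every constraint it meets tight. -/
theorem exists_tight_pureBlind [Nonempty A] (m : ℕ) (y : FullPlan A B) :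
    ∃ (l : (t : ℕ) → (Fin (t + 1) → K) → (Fin t → A) → ℝ) (β : FullBlind K A),
      G.FullFeasible m y l ∧ ∀ (α : K → ℝ) (q : stdSimplex ℝ K),
        G.dualPayoff α (q, β.toFull.restrict m) (y.toFull.restrict m) =
          ∑ k, q k * (α k + l 0 (fun _ => k) (fun i => i.elim0)) := by
  have hs : ∀ t < m, ∀ S I, G.leastBound y (m - t) t S I =
      ⨆ a, ∑ k, G.leastBound y (m - (t + 1)) (t + 1) (ext S k) (ext I a) := by
    intro t ht S I
    obtain ⟨r, hr⟩ : ∃ r, m - t = r + 1 := ⟨m - t - 1, by omega⟩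
    rw [hr, show m - (t + 1) = r by omega]
    rfl
  have hf : ∀ S I, G.leastBound y (m - m) m S I =
      ⨆ a, G.transWeight m S I * G.planPayoff y (m + 1) S (ext I a) := by
    intro S I
    rw [Nat.sub_self]
    rfl
  have hg : ∀ t, ∀ S : Fin (t + 1) → K, ∀ I : Fin t → A, ∃ a,
      (t < m → ∑ k, G.leastBound y (m - (t + 1)) (t + 1) (ext S k) (ext I a) =
        G.leastBound y (m - t) t S I) ∧
      (t = m → G.transWeight t S I * G.planPayoff y (t + 1) S (ext I a) =
        G.leastBound y (m - t) t S I) := by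
    intro t S I
    rcases lt_trichotomy t m with h | h | h
    · obtain ⟨a, ha⟩ := exists_eq_ciSup_of_finite
        (f := fun a => ∑ k, G.leastBound y (m - (t + 1)) (t + 1) (ext S k) (ext I a))
      exact ⟨a, fun _ => ha.trans (hs t h S I).symm, fun h' => absurd h' h.ne⟩
    · subst h
      obtain ⟨a, ha⟩ := exists_eq_ciSup_of_finite
        (f := fun a => G.transWeight t S I * G.planPayoff y (t + 1) S (ext I a))
      exact ⟨a, fun h' => absurd h' (lt_irrefl t), fun _ => ha.trans (hf S I).symm⟩
    -- Stages after the horizon carry no requirement.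
    · exact ⟨Classical.arbitrary A, fun h' => absurd h' h.not_gt, fun h' => absurd h' h.ne'⟩
  choose g hg1 hg2 using hg
  refine ⟨fun t => G.leastBound y (m - t) t, pureBlind g, ⟨fun t ht S I a => ?_, fun S I a => ?_⟩,
    dualPayoff_pureBlind (l := fun t => G.leastBound y (m - t) t)
      (fun t ht S I => hg1 t S I ht) (fun S I => hg2 m S I rfl)⟩
  · rw [hs t ht]
    exact le_ciSup (f := fun a => ∑ k, G.leastBound y (m - (t + 1)) (t + 1) (ext S k) (ext I a))
      (Set.finite_range _).bddAbove a
  · rw [hf]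
    exact le_ciSup (f := fun a => G.transWeight m S I * G.planPayoff y (m + 1) S (ext I a))
      (Set.finite_range _).bddAbove a

end StochasticGame

/-! ### Averaging a strategy into a plan -/

section Averaging

variable {A B : Type*} [Fintype A] [Fintype B]

/-- The probability of the actions `b` of the uninformed player, given the actions `a`. -/
noncomputable def replyWeight (τ : FullUninformed A B) (T : ℕ) (a : Fin T → A) (b : Fin T → B) :
    ℝ :=
  ∏ s : Fin T, τ s (pre a s s.isLt.le) (pre b s s.isLt.le) (b s)

theorem replyWeight_ext (τ : FullUninformed A B) (T : ℕ) (a : Fin (T + 1) → A) (b : Fin T → B)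
    (b' : B) : replyWeight τ (T + 1) a (ext b b') =
      replyWeight τ T (pre a T T.le_succ) b * τ T (pre a T T.le_succ) b b' := by
  unfold replyWeight
  rw [Fin.prod_univ_castSucc]
  congr 1
  · refine Finset.prod_congr rfl fun s _ => ?_
    simp only [Fin.val_castSucc, ext_castSucc]
    rw [pre_ext b b' s s.isLt.le]
    rfl
  · simp only [Fin.val_last, ext_last]
    rw [pre_ext b b' T le_rfl]
    rfl

theorem sum_replyWeight (τ : FullUninformed A B) (T : ℕ) (a : Fin T → A) :
    ∑ b, replyWeight τ T a b = 1 := by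
  induction T with
  | zero => simp [replyWeight]
  | succ T ih =>
    simp_rw [sum_ext, replyWeight_ext, ← Finset.mul_sum, stdSimplex.sum_eq_one, mul_one]
    exact ih _

/-- The plan that averages a strategy over the past actions of the uninformed player. -/
noncomputable def FullUninformed.average (τ : FullUninformed A B) : FullPlan A B :=
  fun t I => ⟨fun b' => ∑ b, replyWeight τ t I b * τ t I b b',
    fun b' => Finset.sum_nonneg fun b _ => mul_nonneg
      (Finset.prod_nonneg fun s _ => (τ s _ _).2.1 _) ((τ t I b).2.1 b'), by
    rw [Finset.sum_comm]
    simp_rw [← Finset.mul_sum]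
    refine (Finset.sum_congr rfl fun b _ => ?_).trans (sum_replyWeight τ t I)
    exact (congrArg _ (stdSimplex.sum_eq_one (τ t I b))).trans (mul_one _)⟩

theorem FullUninformed.average_apply (τ : FullUninformed A B) (t : ℕ) (I : Fin t → A) (b' : B) :
    τ.average t I b' = ∑ b, replyWeight τ t I b * τ t I b b' := rfl

theorem FullPlan.average_toFull (y : FullPlan A B) : y.toFull.average = y := by
  funext t I
  refine stdSimplex.ext (funext fun b' => ?_)
  refine (FullUninformed.average_apply y.toFull t I b').trans ?_
  refine (Finset.sum_mul Finset.univ (replyWeight y.toFull t I) (y t I b')).symm.trans ?_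
  rw [sum_replyWeight, one_mul]

/-- For a sum of stage functions only the law of each single `b s` given `a` matters, and that law
is the average of `τ`. -/
theorem sum_replyWeight_mul_sum (τ : FullUninformed A B) (T : ℕ) (a : Fin T → A)
    (c : Fin T → B → ℝ) : ∑ b, replyWeight τ T a b * ∑ s, c s (b s) =
      ∑ s : Fin T, ∑ b, c s b * τ.average s (pre a s s.isLt.le) b := by
  induction T with
  | zero => simp
  | succ T ih =>
    rw [Fin.sum_univ_castSucc]
    refine Eq.trans ?_ (congrArg₂ (· + ·) (ih (pre a T T.le_succ) fun s => c s.castSucc) rfl)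
    simp_rw [sum_ext, replyWeight_ext, Fin.sum_univ_castSucc, ext_castSucc, ext_last, mul_add,
      Finset.sum_add_distrib]
    congr 1
    · refine Finset.sum_congr rfl fun b _ => ?_
      rw [← Finset.sum_mul, ← Finset.mul_sum, stdSimplex.sum_eq_one, mul_one]
    · rw [Finset.sum_comm]
      refine Finset.sum_congr rfl fun b' _ => ?_
      refine Eq.trans ?_ (congrArg _ (τ.average_apply T (pre a T T.le_succ) b').symm)
      rw [Finset.mul_sum]
      exact Finset.sum_congr rfl fun b _ => mul_comm _ _

end Averaging

/-! ### Realization weights of blind strategies -/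

section Realization

variable {K A B : Type*} [Fintype K] [Fintype A] [Fintype B]

/-- The weight that an initial law and a strategy disregarding the actions of the opponent
give to a history. -/
noncomputable def realization (x : stdSimplex ℝ K × FullBlind K A) (T : ℕ)
    (k : Fin (T + 1) → K) (a : Fin T → A) : ℝ :=
  x.1 (k 0) * ∏ s : Fin T, x.2 s (pre k (s + 1) (by omega)) (pre a s s.isLt.le) (a s)

theorem realization_succ (x : stdSimplex ℝ K × FullBlind K A) (T : ℕ)
    (k : Fin (T + 2) → K) (a : Fin (T + 1) → A) :
    realization x (T + 1) k a =
      realization x T (pre k (T + 1) (by omega)) (pre a T T.le_succ) *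
        x.2 T (pre k (T + 1) (by omega)) (pre a T T.le_succ) (a (Fin.last T)) := by
  unfold realization
  rw [Fin.prod_univ_castSucc, ← mul_assoc]
  rfl

theorem realization_nonneg (x : stdSimplex ℝ K × FullBlind K A) (T : ℕ)
    (k : Fin (T + 1) → K) (a : Fin T → A) : 0 ≤ realization x T k a :=
  mul_nonneg (x.1.2.1 _) (Finset.prod_nonneg fun _ _ => (x.2 _ _ _).2.1 _)

/-- A convex combination of realization weights is again a realization weight. -/
theorem exists_realization_combination (x x' : stdSimplex ℝ K × FullBlind K A) {c c' : ℝ}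
    (hc : 0 ≤ c) (hc' : 0 ≤ c') (hcc : c + c' = 1) :
    ∃ x'' : stdSimplex ℝ K × FullBlind K A, ∀ T k a,
      realization x'' T k a = c * realization x T k a + c' * realization x' T k a := by
  have hβ : ∀ (T : ℕ) (k : Fin (T + 1) → K) (a : Fin T → A), ∃ w : stdSimplex ℝ A, ∀ a',
      (c * realization x T k a + c' * realization x' T k a) * w a' =
        c * (realization x T k a * x.2 T k a a') + c' * (realization x' T k a * x'.2 T k a a') := by
    intro T k a
    have h1 := mul_nonneg hc (realization_nonneg x T k a)
    have h2 := mul_nonneg hc' (realization_nonneg x' T k a)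
    rcases (add_nonneg h1 h2).eq_or_lt' with h0 | h0
    -- A history of combined weight zero has weight zero in both terms, so any mixed action serves.
    · refine ⟨x.2 T k a, fun a' => ?_⟩
      have e1 : c * realization x T k a = 0 := by linarith
      have e2 : c' * realization x' T k a = 0 := by linarith
      rw [← mul_assoc, ← mul_assoc, e1, e2]
      ring
    -- Otherwise the two mixed actions are mixed in proportion to their contributions to the weight
    -- of the history.
    · have hw := convex_stdSimplex ℝ A (x.2 T k a).2 (x'.2 T k a).2
        (div_nonneg h1 h0.le) (div_nonneg h2 h0.le) (by rw [← add_div, div_self h0.ne'])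
      refine ⟨⟨_, hw⟩, fun a' => ?_⟩
      change _ * (c * realization x T k a / _ * x.2 T k a a' +
        c' * realization x' T k a / _ * x'.2 T k a a') = _
      field_simp
  choose β hβ using hβ
  refine ⟨(⟨_, convex_stdSimplex ℝ K x.1.2 x'.1.2 hc hc' hcc⟩, β), fun T => ?_⟩
  induction T with
  | zero =>
    intro k a
    simp only [realization, Finset.univ_eq_empty, Finset.prod_empty, mul_one]
    rfl
  | succ T ih =>
    intro k a
    rw [realization_succ, ih, realization_succ, realization_succ]
    exact hβ _ _ _ _

theorem continuous_realization (T : ℕ) (k : Fin (T + 1) → K) (a : Fin T → A) :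
    Continuous fun x : stdSimplex ℝ K × FullBlind K A => realization x T k a := by
  have hA : ∀ a : A, Continuous fun w : stdSimplex ℝ A => w a := fun a =>
    (continuous_apply a).comp continuous_subtype_val
  have hK : ∀ k : K, Continuous fun w : stdSimplex ℝ K => w k := fun a =>
    (continuous_apply a).comp continuous_subtype_val
  unfold realization
  refine ((hK _).comp continuous_fst).mul (continuous_finsetProd _ fun s _ => (hA _).comp ?_)
  fun_prop

/-- The realization weights of the complete histories of a game with `m + 1` stages. -/
noncomputable def terminalWeight (m : ℕ) (x : stdSimplex ℝ K × FullBlind K A)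
    (k : Fin (m + 1) → K) (a : Fin (m + 1) → A) : ℝ :=
  -- The appended state `k 0` is a dummy: no choice among the `m + 1` actions depends on it.
  realization x (m + 1) (ext k (k 0)) a

end Realization

/-! ### The saddle point for blind strategies and plans -/

namespace StochasticGame

variable {K A B : Type*} [Fintype K] [Fintype A] [Fintype B] (G : StochasticGame K A B)

/-- The payoff of the dual game as a function of a plan of the uninformed player and of the
realization weights of the informed player. -/
noncomputable def bilinearPayoff (α : K → ℝ) (m : ℕ) (y : (t : ℕ) → (Fin t → A) → B → ℝ)
    (r : (Fin (m + 1) → K) → (Fin (m + 1) → A) → ℝ) : ℝ :=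
  ∑ k, ∑ a, r k a * (G.transProd k a *
    (α (k 0) + ∑ t : Fin (m + 1), ∑ b, G.payoff (k t) (a t) b * y t (pre a t t.isLt.le) b))

/-- Blindness factors the probability of a play into a weight of states and player 1's actions,
times the law of `b` given `a`. The payoff is additive over stages, so `τ` enters only through its
average. -/
theorem dualPayoff_blind (α : K → ℝ) (m : ℕ) (x : stdSimplex ℝ K × FullBlind K A)
    (τ : FullUninformed A B) :
    G.dualPayoff α (x.1, x.2.toFull.restrict m) (τ.restrict m) =
      G.bilinearPayoff α m (fun t I b => τ.average t I b) (terminalWeight m x) := by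
  unfold dualPayoff expect bilinearPayoff
  refine Finset.sum_congr rfl fun k _ => Finset.sum_congr rfl fun a _ => ?_
  have hp : ∀ b, G.playProb x.1 (x.2.toFull.restrict m) (τ.restrict m) k a b =
      terminalWeight m x k a * G.transProd k a * replyWeight τ (m + 1) a b := by
    intro b
    have hk : ∀ s : Fin (m + 1), pre (ext k (k 0)) (s + 1) (by omega) = pre k (s + 1) s.isLt :=
      fun s => pre_ext k (k 0) (s + 1) s.isLt _
    unfold playProb terminalWeight realization replyWeight
    simp_rw [hk, ext_zero]
    rw [Finset.prod_mul_distrib, mul_right_comm _ _ (G.transProd k a), ← mul_assoc]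
    rfl
  simp_rw [hp]
  rw [← sum_replyWeight_mul_sum τ (m + 1) a fun s b => G.payoff (k s) (a s) b]
  simp_rw [mul_add, Finset.sum_add_distrib, mul_assoc, ← Finset.mul_sum]
  rw [← Finset.sum_mul, sum_replyWeight, one_mul]

theorem dualPayoff_average (α : K → ℝ) (m : ℕ) (q : stdSimplex ℝ K) (β : FullBlind K A)
    (τ : FullUninformed A B) :
    G.dualPayoff α (q, β.toFull.restrict m) (τ.average.toFull.restrict m) =
      G.dualPayoff α (q, β.toFull.restrict m) (τ.restrict m) := by
  rw [G.dualPayoff_blind α m (q, β), G.dualPayoff_blind α m (q, β), FullPlan.average_toFull]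

theorem continuous_bilinearPayoff_left (α : K → ℝ) (m : ℕ)
    (r : (Fin (m + 1) → K) → (Fin (m + 1) → A) → ℝ) :
    Continuous fun y : (t : ℕ) → (Fin t → A) → B → ℝ => G.bilinearPayoff α m y r := by
  unfold bilinearPayoff
  fun_prop

theorem continuous_bilinearPayoff_right (α : K → ℝ) (m : ℕ)
    (y : (t : ℕ) → (Fin t → A) → B → ℝ) :
    Continuous fun r => G.bilinearPayoff α m y r := by
  unfold bilinearPayoff
  fun_prop

theorem bilinearPayoff_combination_left (α : K → ℝ) (m : ℕ)
    (r : (Fin (m + 1) → K) → (Fin (m + 1) → A) → ℝ) (y y' : (t : ℕ) → (Fin t → A) → B → ℝ)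
    {c c' : ℝ} (h : c + c' = 1) :
    G.bilinearPayoff α m (c • y + c' • y') r =
      c * G.bilinearPayoff α m y r + c' * G.bilinearPayoff α m y' r := by
  unfold bilinearPayoff
  simp_rw [Finset.mul_sum (a := c), Finset.mul_sum (a := c'), ← Finset.sum_add_distrib]
  refine Finset.sum_congr rfl fun k _ => Finset.sum_congr rfl fun a _ => ?_
  have hs : ∑ t : Fin (m + 1), ∑ b, G.payoff (k t) (a t) b *
        (c • y + c' • y') t (pre a t t.isLt.le) b =
      c * ∑ t : Fin (m + 1), ∑ b, G.payoff (k t) (a t) b * y t (pre a t t.isLt.le) b +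
      c' * ∑ t : Fin (m + 1), ∑ b, G.payoff (k t) (a t) b * y' t (pre a t t.isLt.le) b := by
    simp_rw [Finset.mul_sum, ← Finset.sum_add_distrib]
    refine Finset.sum_congr rfl fun t _ => Finset.sum_congr rfl fun b _ => ?_
    simp only [Pi.add_apply, Pi.smul_apply, smul_eq_mul]
    ring
  rw [hs]
  -- The term in `α` is constant in `y`, so the payoff is only affine there and `c + c' = 1` is
  -- needed.
  linear_combination -(r k a * (G.transProd k a * α (k 0))) * h

theorem bilinearPayoff_combination_right (α : K → ℝ) (m : ℕ)
    (y : (t : ℕ) → (Fin t → A) → B → ℝ) (r r' : (Fin (m + 1) → K) → (Fin (m + 1) → A) → ℝ)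
    (c c' : ℝ) :
    G.bilinearPayoff α m y (c • r + c' • r') =
      c * G.bilinearPayoff α m y r + c' * G.bilinearPayoff α m y r' := by
  unfold bilinearPayoff
  simp_rw [Finset.mul_sum (a := c), Finset.mul_sum (a := c'), ← Finset.sum_add_distrib]
  refine Finset.sum_congr rfl fun k _ => Finset.sum_congr rfl fun a _ => ?_
  simp only [Pi.add_apply, Pi.smul_apply, smul_eq_mul]
  ring

/-- The dual game has a saddle point if the informed player disregards the actions of the
opponent and the uninformed player follows a plan. -/
theorem exists_saddlePoint [Nonempty K] [Nonempty A] [Nonempty B] (α : K → ℝ) (m : ℕ) :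
    ∃ (x : stdSimplex ℝ K × FullBlind K A) (y : FullPlan A B),
      ∀ (x' : stdSimplex ℝ K × FullBlind K A) (y' : FullPlan A B),
        G.dualPayoff α (x'.1, x'.2.toFull.restrict m) (y.toFull.restrict m) ≤
          G.dualPayoff α (x.1, x.2.toFull.restrict m) (y'.toFull.restrict m) := by
  let Y : Set ((t : ℕ) → (Fin t → A) → B → ℝ) :=
    Set.pi Set.univ fun t => Set.pi Set.univ fun I => stdSimplex ℝ B
  -- The payoff is not linear in behavior probabilities, but it is linear in their realization
  -- weights, whose range is convex and compact.
  let R : Set ((Fin (m + 1) → K) → (Fin (m + 1) → A) → ℝ) := Set.range (terminalWeight m)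
  have hYne : Y.Nonempty :=
    ⟨fun _ _ => (Classical.arbitrary (stdSimplex ℝ B)).1, fun _ _ _ _ => Subtype.prop _⟩
  have hYconv : Convex ℝ Y :=
    convex_pi fun _ _ => convex_pi fun _ _ => convex_stdSimplex ℝ B
  have hYcomp : IsCompact Y :=
    isCompact_univ_pi fun _ => isCompact_univ_pi fun _ => isCompact_stdSimplex ℝ B
  have hRcomp : IsCompact R := isCompact_range <| continuous_pi fun k => continuous_pi fun a =>
    continuous_realization (m + 1) (ext k (k 0)) a
  have hRconv : Convex ℝ R := by
    rintro _ ⟨x, rfl⟩ _ ⟨x', rfl⟩ c c' hc hc' hcc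
    obtain ⟨x'', h⟩ := exists_realization_combination x x' hc hc' hcc
    exact ⟨x'', funext fun k => funext fun a => h _ _ _⟩
  obtain ⟨y, hy, _, ⟨x, rfl⟩, h⟩ := Sion.exists_isSaddlePointOn
    (f := fun y r => G.bilinearPayoff α m y r) hYne hYconv hYcomp
    (fun r _ => (G.continuous_bilinearPayoff_left α m r).lowerSemicontinuous.lowerSemicontinuousOn _)
    (fun r _ => ConvexOn.quasiconvexOn ⟨hYconv, fun y _ y' _ c c' _ _ hcc =>
      (G.bilinearPayoff_combination_left α m r y y' hcc).le⟩)
    hRconv (Set.range_nonempty _) hRcomp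
    (fun y _ =>
      (G.continuous_bilinearPayoff_right α m y).upperSemicontinuous.upperSemicontinuousOn _)
    (fun y _ => ConcaveOn.quasiconcaveOn ⟨hRconv, fun r _ r' _ c c' _ _ _ =>
      (G.bilinearPayoff_combination_right α m y r r' c c').ge⟩)
  refine ⟨x, fun t I => ⟨y t I, hy t trivial I trivial⟩, fun x' y' => ?_⟩
  rw [dualPayoff_blind, dualPayoff_blind, FullPlan.average_toFull, FullPlan.average_toFull]
  exact h _ (fun t _ I _ => (y' t I).2) _ ⟨x', rfl⟩

end StochasticGame

theorem IsValue.of_saddlePoint {X Y : Type*} {u : X → Y → ℝ} {x : X} {y : Y}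
    (h : ∀ x' y', u x' y ≤ u x y') : IsValue u (u x y) where
  maxmin := ⟨⟨x, ⟨y, rfl⟩, by rintro _ ⟨y', rfl⟩; exact h x y'⟩, by
    rintro c ⟨x', hc⟩
    exact (hc.2 ⟨y, rfl⟩).trans (h x' y)⟩
  minmax := ⟨⟨y, ⟨x, rfl⟩, by rintro _ ⟨x', rfl⟩; exact h x' y⟩, by
    rintro c ⟨y', hc⟩
    exact (h x y').trans (hc.2 ⟨x, rfl⟩)⟩

/-! ### The value of the dual game and the main theorem -/

namespace StochasticGame

variable {K A B : Type*} [Fintype K] [Fintype A] [Fintype B] [Nonempty A] [Nonempty B]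
  (G : StochasticGame K A B)

/-- The restricted saddle point is one among all strategies: against `y` no `σ` beats the blind
tight strategy `β`, and against the blind `x` any `τ` is equivalent to its average. -/
theorem exists_isValue_dualPayoff [Nonempty K] (α : K → ℝ) (m : ℕ) :
    ∃ v, IsValue (G.dualPayoff (m := m) α) v := by
  obtain ⟨x, y, h⟩ := G.exists_saddlePoint (A := A) (B := B) α m
  obtain ⟨l, β, hl, hβ⟩ := G.exists_tight_pureBlind m y
  refine ⟨_, IsValue.of_saddlePoint (x := (x.1, x.2.toFull.restrict m))
    (y := y.toFull.restrict m) fun x' τ => ?_⟩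
  obtain ⟨q, σ⟩ := x'
  obtain ⟨σ, rfl⟩ := exists_restrict_informed σ
  obtain ⟨τ, rfl⟩ := exists_restrict_uninformed τ
  rw [← dualPayoff_average]
  exact (hl.dualPayoff_le α q σ).trans ((hβ α q).ge.trans (h (q, β) τ.average))

theorem primalPayoff_eq_dualPayoff {m : ℕ} (p : stdSimplex ℝ K) (σ : InformedStrategy K A B m)
    (τ : UninformedStrategy A B m) : G.primalPayoff p σ τ = G.dualPayoff 0 (p, σ) τ := by
  simp [primalPayoff, dualPayoff]

end StochasticGame

end AsymGame

/-- The horizon is `n = m + 1 ≥ 1`, and `w` is the (unique) value function of the dual games. -/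
theorem mainTheorem7 {K A B : Type*} [Fintype K] [Fintype A] [Fintype B] [Nonempty A] [Nonempty B]
    (G : AsymGame.StochasticGame K A B) (m : ℕ) (p : stdSimplex ℝ K)
    (y : AsymGame.PlanY A B m) (l : AsymGame.PlanL K A m) (hopt : G.LPOptimal p y l) :
    (∃ w : (K → ℝ) → ℝ,
      (∀ α : K → ℝ, AsymGame.IsValue (G.dualPayoff (m := m) α) (w α)) ∧
      IsMinOn (fun α : K → ℝ => w α - ∑ k, (p : K → ℝ) k * α k) Set.univ (fun k => -l.first k)) ∧
    AsymGame.IsMinSecurity (G.primalPayoff (m := m) p) y.toStrategy ∧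
    (∀ k : K, 0 < (p : K → ℝ) k → G.IsInitialRegretAt y.toStrategy k (-l.first k)) := by
  open AsymGame StochasticGame in
  have : Nonempty K := by
    by_contra hK
    have := not_nonempty_iff.mp hK
    simpa using stdSimplex.sum_eq_one p
  obtain ⟨y, rfl⟩ := exists_restrict_plan y
  obtain ⟨l, rfl⟩ := exists_restrict_bound l
  set L : K → ℝ := PlanL.first (m := m) fun t => l t
  have hfeas := (G.lpFeasible_restrict_iff y l).1 hopt.feasible
  have hle : ∀ α q σ, G.dualPayoff α (q, σ) (y.restrict m).toStrategy ≤
      ∑ k, q k * (α k + L k) := by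
    intro α q σ
    obtain ⟨σ, rfl⟩ := exists_restrict_informed σ
    exact hfeas.dualPayoff_le α q σ
  -- every strategy of the uninformed player concedes the value of the program
  have hge : ∀ α (τ : UninformedStrategy A B m), ∃ σ, ∑ k, p k * (α k + L k) ≤ G.dualPayoff α (p, σ) τ := by
    intro α τ
    obtain ⟨τ, rfl⟩ := exists_restrict_uninformed τ
    -- The averaged plan with its tight bounds is feasible, hence costs at least the optimum, and
    -- `β` collects that cost from `τ` itself.
    obtain ⟨l', β, hl', hβ⟩ := G.exists_tight_pureBlind m τ.average
    refine ⟨β.toFull.restrict m, ?_⟩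
    rw [← dualPayoff_average, hβ]
    have := hopt.le_of_feasible _ _ ((G.lpFeasible_restrict_iff τ.average l').2 hl')
    simp_rw [mul_add, Finset.sum_add_distrib]
    exact add_le_add_right this _
  obtain ⟨l', β, hl', hβ⟩ := G.exists_tight_pureBlind m y
  have hattain : ∀ k, 0 < p k → l' 0 (fun _ => k) (fun i => i.elim0) = L k := by
    classical
    -- Starting from the point mass at `k`, `β` attains `l'`, while feasibility of `l` caps the
    -- payoff at `L k`.
    have hl : ∀ k, l' 0 (fun _ => k) (fun i => i.elim0) ≤ L k := by
      intro k
      have h := hle 0 (stdSimplex.vertex k) (β.toFull.restrict m)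
      have h' := hβ 0 (stdSimplex.vertex k)
      have h'' := h'.ge.trans h
      simpa [stdSimplex.vertex_coe, Pi.single_apply] using h''
    have hopt' : ∑ k, p k * L k ≤ ∑ k, p k * l' 0 (fun _ => k) (fun i => i.elim0) :=
      hopt.le_of_feasible _ _ ((G.lpFeasible_restrict_iff y l').2 hl')
    have hterm : ∀ k ∈ Finset.univ, p k * l' 0 (fun _ => k) (fun i => i.elim0) ≤ p k * L k :=
      fun k _ => mul_le_mul_of_nonneg_left (hl k) (p.2.1 k)
    intro k hk
    have := (Finset.sum_eq_sum_iff_of_le hterm).1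
      (le_antisymm (Finset.sum_le_sum hterm) hopt') k (Finset.mem_univ k)
    exact mul_left_cancel₀ hk.ne' this
  have hzero : ∀ q : stdSimplex ℝ K, ∑ k, q k * ((0 : K → ℝ) k + L k) = ∑ k, q k * L k := by
    simp
  refine ⟨?_, ?_, ?_⟩
  · choose w hw using fun α : K → ℝ => G.exists_isValue_dualPayoff α m
    refine ⟨w, hw, fun α _ => ?_⟩
    -- With `α = -L` the upper bound conceded by the optimal plan is zero for every initial law.
    have h1 : w (fun k => -L k) ≤ 0 := by
      obtain ⟨⟨x, hx⟩, -⟩ := (hw fun k => -L k).maxmin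
      refine (hx.2 ⟨(y.restrict m).toStrategy, rfl⟩).trans ((hle _ x.1 x.2).trans ?_)
      simp
    -- Player 1 may choose the law `p` and exploit an optimal `τ` of the dual game.
    have h2 : ∑ k, p k * (α k + L k) ≤ w α := by
      obtain ⟨⟨τ, hτ⟩, -⟩ := (hw α).minmax
      obtain ⟨σ, hσ⟩ := hge α τ
      exact hσ.trans (hτ.2 ⟨(p, σ), rfl⟩)
    simp only [mul_add, Finset.sum_add_distrib] at h2
    simp only [Set.mem_ofPred_eq, mul_neg, Finset.sum_neg_distrib]
    linarith
  · have hmax : IsGreatest (Set.range fun σ => G.primalPayoff p σ (y.restrict m).toStrategy)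
        (∑ k, p k * L k) := by
      constructor
      · refine (hge 0 (y.restrict m).toStrategy).imp fun σ hσ => ?_
        simp only [primalPayoff_eq_dualPayoff]
        rw [← hzero]
        exact (hle 0 p σ).antisymm hσ
      · rintro _ ⟨σ, rfl⟩
        simp only [primalPayoff_eq_dualPayoff]
        rw [← hzero]
        exact hle 0 p σ
    refine ⟨_, ⟨⟨_, hmax⟩, ?_⟩, hmax⟩
    rintro c ⟨τ, hτ⟩
    obtain ⟨σ, hσ⟩ := hge 0 τ
    rw [hzero, ← primalPayoff_eq_dualPayoff] at hσ
    exact hσ.trans (hτ.2 ⟨σ, rfl⟩)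
  · classical
    intro k hk
    unfold IsInitialRegretAt
    rw [neg_neg]
    simp only [payoffFrom, primalPayoff_eq_dualPayoff]
    -- Of the point mass at `k` only its evaluation property is used; one strategy `β` attains the
    -- maximum for all `k` in the support.
    have hsum : ∀ q : stdSimplex ℝ K, (∀ f : K → ℝ, ∑ j, q j * f j = f k) →
        IsGreatest (Set.range fun σ => G.dualPayoff 0 (q, σ) (y.restrict m).toStrategy) (L k) := by
      intro q hq
      refine ⟨⟨β.toFull.restrict m, ?_⟩, ?_⟩
      · refine (hβ 0 q).trans ((hq _).trans ?_)
        rw [hattain k hk, Pi.zero_apply, zero_add]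
      · rintro _ ⟨σ, rfl⟩
        refine (hle 0 q σ).trans ((hq _).trans_le ?_)
        rw [Pi.zero_apply, zero_add]
    refine hsum _ fun f => ?_
    refine (Finset.sum_eq_single k (fun j _ hj => ?_) fun h => (h (Finset.mem_univ k)).elim).trans ?_
    · exact mul_eq_zero_of_left (Pi.single_eq_of_ne (M := fun _ : K => ℝ) hj 1) _
    · exact (congrArg (· * f k) (Pi.single_eq_same (M := fun _ : K => ℝ) k 1)).trans (one_mul _)
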